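/- Let $\Omega\subset\mathbb{C}^n$ be a B-regular domain, i.e. a bounded domain such that every continuous function $f:\partial\Omega\to\mathbb{R}$ extends to a continuous function on $\bar\Omega$ that is plurisubharmonic in $\Omega$. Plurisubharmonic functions take values in $[-\infty,\infty)$ and are not identically $-\infty$. For $u:\Omega\to[-\infty,\infty)$ and $z\in\bar\Omega$ write $$u^*(z)=\limsup_{\Omega\ni w\to z}u(w),\qquad u_*(z)=\liminf_{\Omega\ni w\to z}u(w).$$ For $E\subset\partial\Omega$ let $\mathscr{F}_E$ be the set of plurisubharmonic functions $u<0$ on $\Omega$ such that $u^*=-\infty$ at every point of $E$. The set $E$ is called b-pluripolar if $\mathscr{F}_E\neq\emptyset$. In that case let $$E^{\ast}=\bigcap_{u\in\mathscr{F}_E}\{z\in\bar\Omega: u_*(z)=-\infty\},\qquad \hat E=\bigcap_{u\in\mathscr{F}_E}\{z\in\bar\Omega: u^*(z)=-\infty\}$$ be the propagating singularity set and the b-pluripolar hull of $E$. Let $\varphi:\partial\Omega\to\mathbb{R}\cup\{-\infty,\infty\}$ be any function, and let $E_\varphi\subset\partial\Omega$ be the set of points at which $\varphi$ is discontinuous (as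 a map into the extended reals) or equal to $\pm\infty$. If $E_\varphi$ is b-pluripolar, then $E_\varphi^{\ast}=\overline{\hat E_\varphi}$. -/

import Mathlib

open Filter Topology MeasureTheory

noncomputable section

namespace Pluripotential

/-- Complex Euclidean space `ℂⁿ`. -/
abbrev Cn (n : ℕ) : Type := EuclideanSpace ℂ (Fin n)

/-- The Lebesgue mean `(1/2π) ∫₀^{2π} u (a + e^{iθ} b) dθ` of an extended real function over the
circle with centre `a` and direction vector `b`, as the mean of the positive part minus the mean of
the negative part.  For an upper semicontinuous `u < +∞` the first mean is finite, so that no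
`∞ - ∞` occurs. -/
def circleMean {n : ℕ} (u : Cn n → EReal) (a b : Cn n) : EReal :=
  ((⨍⁻ θ in Set.Ioc (0 : ℝ) (2 * Real.pi),
      (u (a + Complex.exp (θ * Complex.I) • b)).toENNReal ∂volume : ENNReal) : EReal) -
    ((⨍⁻ θ in Set.Ioc (0 : ℝ) (2 * Real.pi),
      (-u (a + Complex.exp (θ * Complex.I) • b)).toENNReal ∂volume : ENNReal) : EReal)

/-- `u ∈ PSH(Ω)`: upper semicontinuous on `Ω` with values in `[-∞, ∞)`, not identically `-∞`, and
satisfying the sub-mean value inequality on every closed disc of a complex line that is contained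
in `Ω`.  The values of `u` outside `Ω` are irrelevant. -/
structure IsPSH {n : ℕ} (Ω : Set (Cn n)) (u : Cn n → EReal) : Prop where
  usc : UpperSemicontinuousOn u Ω
  lt_top : ∀ z ∈ Ω, u z < ⊤
  ne_bot : ∃ z ∈ Ω, u z ≠ ⊥
  submean : ∀ a ∈ Ω, ∀ b : Cn n, (∀ t : ℂ, ‖t‖ ≤ 1 → a + t • b ∈ Ω) → u a ≤ circleMean u a b

/-- A B-regular domain: a bounded domain such that every continuous real function on the boundary
is the boundary value of a function that is continuous on the closure and plurisubharmonic
inside. -/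
structure IsBRegular {n : ℕ} (Ω : Set (Cn n)) : Prop where
  isOpen : IsOpen Ω
  isConnected : IsConnected Ω
  isBounded : Bornology.IsBounded Ω
  extend : ∀ f : C(frontier Ω, ℝ), ∃ h : Cn n → ℝ,
    ContinuousOn h (closure Ω) ∧ IsPSH Ω (fun z => (h z : EReal)) ∧ ∀ ζ : frontier Ω, h ζ = f ζ

/-- `u^*(z) = limsup_{Ω ∋ w → z} u(w)`. -/
def upperReg {n : ℕ} (Ω : Set (Cn n)) (u : Cn n → EReal) (z : Cn n) : EReal :=
  limsup u (𝓝[Ω] z)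

/-- `u_*(z) = liminf_{Ω ∋ w → z} u(w)`. -/
def lowerReg {n : ℕ} (Ω : Set (Cn n)) (u : Cn n → EReal) (z : Cn n) : EReal :=
  liminf u (𝓝[Ω] z)

/-- A set `A ⊆ ∂Ω` is b-pluripolar if some negative plurisubharmonic function on `Ω` (not
identically `-∞`) tends to `-∞` at every point of `A`. -/
def IsBPluripolar {n : ℕ} (Ω A : Set (Cn n)) : Prop :=
  A ⊆ frontier Ω ∧
    ∃ u : Cn n → EReal, IsPSH Ω u ∧ (∀ z ∈ Ω, u z < 0) ∧ ∀ ζ ∈ A, upperReg Ω u ζ = ⊥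

/-- The family `𝓕_E` of negative plurisubharmonic functions `u` on `Ω` with `u^* = -∞` on `E`. -/
def singularFamily {n : ℕ} (Ω E : Set (Cn n)) : Set (Cn n → EReal) :=
  {u | IsPSH Ω u ∧ (∀ z ∈ Ω, u z < 0) ∧ ∀ ζ ∈ E, upperReg Ω u ζ = ⊥}

/-- The propagating singularity set `E^*`, a subset of the closure of `Ω`. -/
def propagatingSet {n : ℕ} (Ω E : Set (Cn n)) : Set (Cn n) :=
  {z ∈ closure Ω | ∀ u ∈ singularFamily Ω E, lowerReg Ω u z = ⊥}

/-- The b-pluripolar hull `Ê`, a subset of the closure of `Ω`. -/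
def bPluripolarHull {n : ℕ} (Ω E : Set (Cn n)) : Set (Cn n) :=
  {z ∈ closure Ω | ∀ u ∈ singularFamily Ω E, upperReg Ω u z = ⊥}

/-- The set `E_φ ⊆ ∂Ω` of the boundary points at which `φ` is discontinuous or infinite. -/
def singularSet {n : ℕ} {Ω : Set (Cn n)} (φ : frontier Ω → EReal) : Set (Cn n) :=
  Subtype.val '' {ζ : frontier Ω | ¬ ContinuousAt φ ζ ∨ φ ζ = ⊤ ∨ φ ζ = ⊥}

end Pluripotential

end

open Filter Topology MeasureTheory

noncomputable section

namespace Pluripotential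

/-! One inclusion is soft: `u_* ≤ u^*` on the closure of `Ω` and `u_*` is lower semicontinuous, so
each set `{u_* = -∞}` is closed and contains the hull.

For the converse, `E` is a countable union of compact sets. Near a point `z₀` off the closure of the
hull one builds a member of `𝓕_E` bounded below, as minus a sum of nonnegative superharmonic `t j`,
each at least `1` near the first `j + 1` compacts and at most `η j` near `z₀`, with `∑ η j < 1`.

The heart is `exists_locally_bounded`. A point `w ∈ Ω` off the hull has some `u ∈ 𝓕_E` with `u w >
-∞`, but `u` may be unbounded below near `w`. Following Walsh, a small multiple of `-u` is replaced
by the infimum of its small translates, which is controlled on a whole neighbourhood of `w`. Near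
`∂Ω` this infimum dominates a continuous barrier supplied by B-regularity, and the minimum of the
two is superharmonic. Compactness and finite minima pass from points to a ball.

Working with `[0, ∞]`-valued superharmonic functions avoids `∞ - ∞` and makes infinite sums
harmless. -/

/-- The uniform probability measure on the angles `(0, 2π]`. -/
def uniformAngle : Measure ℝ :=
  (volume.restrict (Set.Ioc (0 : ℝ) (2 * Real.pi)) Set.univ)⁻¹ •
    volume.restrict (Set.Ioc (0 : ℝ) (2 * Real.pi))

instance : IsProbabilityMeasure uniformAngle := by
  have h0 : volume.restrict (Set.Ioc (0 : ℝ) (2 * Real.pi)) Set.univ ≠ 0 := by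
    simp [Real.pi_pos]
  have h1 : volume.restrict (Set.Ioc (0 : ℝ) (2 * Real.pi)) Set.univ ≠ ⊤ := by
    rw [Measure.restrict_apply_univ]
    exact measure_Ioc_lt_top.ne
  exact ⟨by rw [uniformAngle, Measure.smul_apply, smul_eq_mul, ENNReal.inv_mul_cancel h0 h1]⟩

/-- The mean of a nonnegative extended real function over the circle with centre `a` and direction
vector `b`. -/
def discMean {V : Type*} [AddCommGroup V] [Module ℂ V] (s : V → ENNReal) (a b : V) : ENNReal :=
  ∫⁻ θ, s (a + Complex.exp ((θ : ℝ) * Complex.I) • b) ∂uniformAngle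

/-- `uniformAngle` is spelled exactly as the average `⨍⁻` unfolds, so the identity is definitional.
-/
theorem circleMean_eq {n : ℕ} (u : Cn n → EReal) (a b : Cn n) :
    circleMean u a b = (discMean (fun z => (u z).toENNReal) a b : EReal) -
      (discMean (fun z => (-u z).toENNReal) a b : EReal) := rfl

theorem norm_exp_mul_I (θ : ℝ) : ‖Complex.exp (θ * Complex.I)‖ = 1 :=
  Complex.norm_exp_ofReal_mul_I θ

section DiscMean

variable {V : Type*} [AddCommGroup V] [Module ℂ V]

theorem discMean_mono {s t : V → ENNReal} {a b : V}
    (h : ∀ c : ℂ, ‖c‖ = 1 → s (a + c • b) ≤ t (a + c • b)) : discMean s a b ≤ discMean t a b :=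
  lintegral_mono fun θ => h _ (norm_exp_mul_I θ)

theorem discMean_congr {s t : V → ENNReal} {a b : V}
    (h : ∀ c : ℂ, ‖c‖ = 1 → s (a + c • b) = t (a + c • b)) : discMean s a b = discMean t a b :=
  lintegral_congr fun θ => h _ (norm_exp_mul_I θ)

theorem discMean_const (c : ENNReal) (a b : V) : discMean (fun _ => c) a b = c := by
  simp [discMean]

theorem lintegral_uniformAngle_ofReal {F : ℂ → ℝ} (hF : Continuous F)
    (h0 : ∀ c : ℂ, ‖c‖ = 1 → 0 ≤ F c) :
    ∫⁻ θ, ENNReal.ofReal (F (Complex.exp ((θ : ℝ) * Complex.I))) ∂uniformAngle =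
      ENNReal.ofReal (Real.circleAverage F 0 1) := by
  have hc : Continuous fun θ : ℝ => F (Complex.exp (θ * Complex.I)) := by fun_prop
  rw [Real.circleAverage_def, intervalIntegral.integral_of_le (by positivity)]
  have hint : IntegrableOn (fun θ : ℝ => F (Complex.exp (θ * Complex.I)))
      (Set.Ioc (0 : ℝ) (2 * Real.pi)) :=
    (hc.continuousOn.integrableOn_Icc).mono_set Set.Ioc_subset_Icc_self
  have hcm : ∀ θ : ℝ, circleMap 0 1 θ = Complex.exp (θ * Complex.I) := by
    intro θ; simp [circleMap]
  simp only [hcm, smul_eq_mul]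
  rw [ENNReal.ofReal_mul (by positivity),
    ofReal_integral_eq_lintegral_ofReal hint (Eventually.of_forall fun θ => h0 _ (norm_exp_mul_I θ)),
    uniformAngle, lintegral_smul_measure, Measure.restrict_apply_univ, Real.volume_Ioc, sub_zero,
    ENNReal.ofReal_inv_of_pos (by positivity), smul_eq_mul]

theorem discMean_ofReal {s : V → ENNReal} {a b : V} {F : ℂ → ℝ} (hF : Continuous F)
    (h0 : ∀ c : ℂ, ‖c‖ = 1 → 0 ≤ F c)
    (h : ∀ c : ℂ, ‖c‖ = 1 → s (a + c • b) = ENNReal.ofReal (F c)) :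
    discMean s a b = ENNReal.ofReal (Real.circleAverage F 0 1) := by
  rw [← lintegral_uniformAngle_ofReal hF h0]
  exact lintegral_congr fun θ => h _ (norm_exp_mul_I θ)

end DiscMean

/-! ### Superharmonic functions on discs and their closure properties -/

/-- Nonnegative functions on an open set that are lower semicontinuous and satisfy the super-mean
value inequality on closed discs in complex lines. -/
structure IsDiscSuperharmonic {V : Type*} [AddCommGroup V] [Module ℂ V] [TopologicalSpace V]
    (Ω : Set V) (s : V → ENNReal) : Prop where
  lsc : LowerSemicontinuousOn s Ω
  supermean : ∀ a ∈ Ω, ∀ b : V, (∀ t : ℂ, ‖t‖ ≤ 1 → a + t • b ∈ Ω) → discMean s a b ≤ s a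

namespace IsDiscSuperharmonic

variable {V : Type*} [AddCommGroup V] [Module ℂ V] [TopologicalSpace V]
  {Ω : Set V} {s t : V → ENNReal}

theorem const (c : ENNReal) : IsDiscSuperharmonic Ω fun _ => c where
  lsc := lowerSemicontinuousOn_const
  supermean a _ b _ := (discMean_const c a b).le

theorem inf (hs : IsDiscSuperharmonic Ω s) (ht : IsDiscSuperharmonic Ω t) :
    IsDiscSuperharmonic Ω fun z => min (s z) (t z) where
  lsc := hs.lsc.inf ht.lsc
  supermean a ha b hd := le_min
    ((discMean_mono fun _ _ => min_le_left _ _).trans (hs.supermean a ha b hd))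
    ((discMean_mono fun _ _ => min_le_right _ _).trans (ht.supermean a ha b hd))

end IsDiscSuperharmonic

section Circle

variable {V : Type*} [AddCommGroup V] [Module ℂ V] [TopologicalSpace V] [ContinuousAdd V]
  [ContinuousSMul ℂ V]

theorem measurable_circle_of_lsc {Ω : Set V} {s : V → ENNReal} (hs : LowerSemicontinuousOn s Ω)
    {a b : V} (hd : ∀ t : ℂ, ‖t‖ ≤ 1 → a + t • b ∈ Ω) :
    Measurable fun θ : ℝ => s (a + Complex.exp (θ * Complex.I) • b) := by
  have h : LowerSemicontinuousOn (s ∘ fun θ : ℝ => a + Complex.exp (θ * Complex.I) • b)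
      Set.univ :=
    hs.comp (by fun_prop) fun θ _ => hd _ (norm_exp_mul_I θ).le
  exact (lowerSemicontinuousOn_univ_iff.1 h).measurable

theorem measurable_circle_of_usc {Ω : Set V} {u : V → EReal} (hu : UpperSemicontinuousOn u Ω)
    {a b : V} (hd : ∀ t : ℂ, ‖t‖ ≤ 1 → a + t • b ∈ Ω) :
    Measurable fun θ : ℝ => u (a + Complex.exp (θ * Complex.I) • b) := by
  have h : UpperSemicontinuousOn (u ∘ fun θ : ℝ => a + Complex.exp (θ * Complex.I) • b)
      Set.univ :=
    hu.comp (by fun_prop) fun θ _ => hd _ (norm_exp_mul_I θ).le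
  exact (upperSemicontinuousOn_univ_iff.1 h).measurable

namespace IsDiscSuperharmonic

variable {Ω : Set V} {s t : V → ENNReal}

theorem add (hs : IsDiscSuperharmonic Ω s) (ht : IsDiscSuperharmonic Ω t) :
    IsDiscSuperharmonic Ω fun z => s z + t z where
  lsc := hs.lsc.add ht.lsc
  supermean a ha b hd := by
    unfold discMean
    rw [lintegral_add_left (measurable_circle_of_lsc hs.lsc hd)]
    exact add_le_add (hs.supermean a ha b hd) (ht.supermean a ha b hd)

theorem tsum {s : ℕ → V → ENNReal} (hs : ∀ i, IsDiscSuperharmonic Ω (s i)) :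
    IsDiscSuperharmonic Ω fun z => ∑' i, s i z where
  lsc := lowerSemicontinuousOn_tsum fun i => (hs i).lsc
  supermean a ha b hd := by
    unfold discMean
    rw [lintegral_tsum fun i => (measurable_circle_of_lsc (hs i).lsc hd).aemeasurable]
    exact ENNReal.tsum_le_tsum fun i => (hs i).supermean a ha b hd

theorem const_mul (hs : IsDiscSuperharmonic Ω s) {c : ENNReal} (hc : c ≠ ⊤) :
    IsDiscSuperharmonic Ω fun z => c * s z where
  lsc := fun z hz =>
    ((ENNReal.continuous_const_mul hc).continuousAt.comp_lowerSemicontinuousWithinAt (hs.lsc z hz)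
      (fun _ _ h => mul_le_mul_right h c))
  supermean a ha b hd := by
    unfold discMean
    rw [lintegral_const_mul _ (measurable_circle_of_lsc hs.lsc hd)]
    gcongr
    exact hs.supermean a ha b hd

end IsDiscSuperharmonic

end Circle

/-- The identity `(c - x) + x⁺ = c + x⁻` without subtraction on the right, so that it integrates
even if `x⁻` has infinite mean. -/
theorem ereal_sub_toENNReal_add {c : ℝ} {x : EReal} (h : x ≤ c) (hc : 0 ≤ c) :
    ((c : EReal) - x).toENNReal + x.toENNReal = ENNReal.ofReal c + (-x).toENNReal := by
  induction x with
  | bot => simp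
  | top => simp at h
  | coe x =>
    have hx : x ≤ c := by exact_mod_cast h
    rw [← EReal.coe_sub, ← EReal.coe_neg]
    simp only [EReal.toENNReal_of_ne_top (EReal.coe_ne_top _), EReal.toReal_coe]
    rcases le_total 0 x with h0 | h0
    · rw [ENNReal.ofReal_of_nonpos (p := -x) (by linarith), add_zero,
        ← ENNReal.ofReal_add (by linarith) h0]
      ring_nf
    · rw [ENNReal.ofReal_of_nonpos h0, add_zero, ← ENNReal.ofReal_add hc (by linarith)]
      ring_nf

variable {n : ℕ}

/-- If `u ≤ c` is plurisubharmonic, then `c - u` is superharmonic on discs. -/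
theorem IsPSH.isDiscSuperharmonic {Ω : Set (Cn n)} {u : Cn n → EReal} (hu : IsPSH Ω u) {c : ℝ}
    (hc : 0 ≤ c) (h : ∀ z ∈ Ω, u z ≤ c) :
    IsDiscSuperharmonic Ω fun z => ((c : EReal) - u z).toENNReal where
  lsc := by
    intro z hz y hy
    have hmono : ∀ x x' : EReal, x ≤ x' → ((c : EReal) - x').toENNReal ≤ ((c : EReal) - x).toENNReal :=
      fun x x' hx => EReal.toENNReal_le_toENNReal (EReal.sub_le_sub le_rfl hx)
    have hcont : Continuous fun x : EReal => ((c : EReal) - x).toENNReal := by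
      refine EReal.continuous_toENNReal.comp ?_
      rw [continuous_iff_continuousAt]
      intro x
      change ContinuousAt (fun x : EReal => (c : EReal) + -x) x
      refine (EReal.continuousAt_add (Or.inl (EReal.coe_ne_top c)) (Or.inl (EReal.coe_ne_bot c))).comp
        (f := fun x : EReal => ((c : EReal), -x)) ?_
      fun_prop
    exact hcont.continuousAt.comp_upperSemicontinuousWithinAt_antitone (hu.usc z hz) hmono y hy
  supermean a ha b hd := by
    have h1 := hu.submean a ha b hd
    rw [circleMean_eq] at h1
    have hsum : discMean (fun z => ((c : EReal) - u z).toENNReal) a b +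
        discMean (fun z => (u z).toENNReal) a b =
        ENNReal.ofReal c + discMean (fun z => (-u z).toENNReal) a b := by
      unfold discMean
      rw [← lintegral_add_right _ (measurable_circle_of_usc hu.usc hd).ereal_toENNReal]
      rw [lintegral_congr fun θ => ereal_sub_toENNReal_add (h _ (hd _ (norm_exp_mul_I θ).le)) hc,
        lintegral_add_left measurable_const]
      simp
    have hP : discMean (fun z => (u z).toENNReal) a b ≤ ENNReal.ofReal c := by
      rw [← discMean_const (ENNReal.ofReal c) a b]
      refine discMean_mono fun t ht => ?_
      have := EReal.toENNReal_le_toENNReal (h _ (hd _ ht.le))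
      rwa [EReal.toENNReal_of_ne_top (EReal.coe_ne_top c), EReal.toReal_coe] at this
    generalize discMean (fun z => ((c : EReal) - u z).toENNReal) a b = S at *
    generalize discMean (fun z => (u z).toENNReal) a b = P at *
    generalize discMean (fun z => (-u z).toENNReal) a b = N at *
    have hPt : P ≠ ⊤ := ne_top_of_le_ne_top ENNReal.ofReal_ne_top hP
    -- If the negative part has infinite mean, the submean inequality forces `u a = -∞`, and the
    -- claim is trivial.
    rcases eq_or_ne N ⊤ with rfl | hN
    · have : u a = ⊥ := by simpa using h1
      simp [this]
    have hS : S ≠ ⊤ := by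
      rintro rfl
      rw [top_add] at hsum
      exact ENNReal.add_ne_top.2 ⟨ENNReal.ofReal_ne_top, hN⟩ hsum.symm
    lift P to NNReal using hPt
    lift N to NNReal using hN
    lift S to NNReal using hS
    lift c to NNReal using hc
    have hsum' : (S : ℝ) + P = c + N := by
      rw [ENNReal.ofReal_coe_nnreal] at hsum
      exact_mod_cast hsum
    have hSc : (S : EReal) = (c : ℝ) - ((P : EReal) - N) := by
      have : (S : ℝ) = c - (P - N) := by linarith
      rw [EReal.coe_nnreal_eq_coe_real, EReal.coe_nnreal_eq_coe_real, EReal.coe_nnreal_eq_coe_real,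
        this]
      push_cast
      rfl
    rw [← EReal.toENNReal_coe (x := (S : ENNReal))]
    refine EReal.toENNReal_le_toENNReal ?_
    refine hSc.le.trans (EReal.sub_le_sub le_rfl h1)

theorem IsDiscSuperharmonic.isPSH_neg {Ω : Set (Cn n)} {s : Cn n → ENNReal}
    (hs : IsDiscSuperharmonic Ω s) (hpos : ∀ z ∈ Ω, 0 < s z) (hfin : ∃ z ∈ Ω, s z ≠ ⊤) :
    IsPSH Ω fun z => -(s z : EReal) where
  usc := by
    intro z hz
    exact (continuous_neg.comp continuous_coe_ennreal_ereal).continuousAt.comp_lowerSemicontinuousWithinAt_antitone (hs.lsc z hz)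
      (fun _ _ h => by simpa using h)
  lt_top z hz := by
    have := hpos z hz
    rw [EReal.neg_lt_comm]
    exact lt_of_lt_of_le EReal.bot_lt_zero (by positivity)
  ne_bot := by
    obtain ⟨z, hz, h⟩ := hfin
    exact ⟨z, hz, by simpa using h⟩
  submean a ha b hd := by
    have h0 : ∀ x : ENNReal, (-(x : EReal)).toENNReal = 0 := fun x =>
      EReal.toENNReal_of_nonpos (by simpa using EReal.coe_ennreal_nonneg x)
    rw [circleMean_eq]
    simp only [neg_neg, EReal.toENNReal_coe, h0, discMean_const]
    simpa using hs.supermean a ha b hd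

/-! ### Approximation by continuous functions and by real parts of entire functions -/

/-- A nonnegative lower semicontinuous function is the increasing limit of finite continuous
functions. -/
theorem exists_monotone_continuous_iSup_eq {X : Type*} [PseudoEMetricSpace X] {S : Set X}
    {s : X → ENNReal} (hs : LowerSemicontinuousOn s S) :
    ∃ t : ℕ → X → ENNReal, (∀ k, Continuous (t k)) ∧ Monotone t ∧ (∀ k x, t k x ≠ ⊤) ∧
      ∀ x ∈ S, ⨆ k, t k x = s x := by
  -- Inf-convolution with `k * edist` is `k`-Lipschitz; truncation at `k` keeps it finite.
  refine ⟨fun k x => min k (⨅ y ∈ S, (s y + k * edist x y)), fun k => ?_, ?_, fun k x => ?_,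
    fun x hx => ?_⟩
  · refine continuous_const.min (continuous_of_le_add_edist k (ENNReal.natCast_ne_top k) ?_)
    intro x x'
    simp only [ENNReal.iInf_add]
    refine le_iInf₂ fun y hy => (iInf₂_le y hy).trans ?_
    rw [add_assoc, ← mul_add]
    gcongr
    rw [add_comm]
    exact edist_triangle _ _ _
  · intro k l hkl x
    have : (k : ENNReal) ≤ l := by exact_mod_cast hkl
    dsimp only
    gcongr
  · exact ne_top_of_le_ne_top (ENNReal.natCast_ne_top k) (min_le_left _ _)
  · refine le_antisymm (iSup_le fun k => (min_le_right _ _).trans ?_) ?_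
    · exact (iInf₂_le x hx).trans (by simp)
    · refine le_of_forall_lt fun c hc => ?_
      obtain ⟨c', hcc', hc'⟩ := exists_between hc
      refine hcc'.trans_le ?_
      have hc't : c' ≠ ⊤ := hc'.ne_top
      obtain ⟨δ, hδ, hδs⟩ := EMetric.mem_nhdsWithin_iff.1 (hs x hx c' hc')
      obtain ⟨δ, hδ, hδt, hδs⟩ : ∃ δ : ENNReal, 0 < δ ∧ δ ≠ ⊤ ∧
          ∀ y ∈ S, edist y x < δ → c' < s y :=
        ⟨min δ 1, by simpa using hδ, by simp, fun y hy h => hδs ⟨h.trans_le (min_le_left _ _), hy⟩⟩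
      -- `k₁` makes the penalty exceed `c'` at distance `≥ δ`; `k₂` lifts the truncation above `c'`.
      obtain ⟨k₁, hk₁⟩ := ENNReal.exists_nat_gt (ENNReal.div_ne_top hc't hδ.ne')
      obtain ⟨k₂, hk₂⟩ := ENNReal.exists_nat_gt hc't
      have h1 : (k₁ : ENNReal) ≤ (max k₁ k₂ : ℕ) := by exact_mod_cast le_max_left _ _
      have h2 : (k₂ : ENNReal) ≤ (max k₁ k₂ : ℕ) := by exact_mod_cast le_max_right _ _
      refine le_iSup_of_le (max k₁ k₂) (le_min (hk₂.le.trans h2) (le_iInf₂ fun y hy => ?_))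
      by_cases hxy : edist y x < δ
      · exact (hδs y hy hxy).le.trans le_self_add
      · refine le_add_left ?_
        rw [edist_comm]
        refine le_trans ?_ (mul_le_mul' (hk₁.le.trans h1) (not_lt.1 hxy))
        rw [ENNReal.div_mul_cancel hδ.ne' hδt]

theorem circleAverage_re {f : ℂ → ℂ} (hf : Differentiable ℂ f) (c : ℂ) (R : ℝ) :
    Real.circleAverage (fun t => (f t).re) c R = (f c).re := by
  have h := Complex.reCLM.circleAverage_comp_comm
    (hf.continuous.continuousOn.circleIntegrable' (c := c) (R := R))
  rw [hf.diffContOnCl.circleAverage] at h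
  exact h

/-- Trigonometric polynomials are dense on the circle, and there `z⁻ᵐ` is the conjugate of `zᵐ`, so
their real parts are real parts of polynomials. This replaces the Poisson integral. -/
theorem exists_differentiable_re_approx {f : ℂ → ℝ} (hf : Continuous f) {ε : ℝ} (hε : 0 < ε) :
    ∃ F : ℂ → ℂ, Differentiable ℂ F ∧ ∀ t : ℂ, ‖t‖ = 1 → |f t - (F t).re| ≤ ε := by
  let g : C(AddCircle (1 : ℝ), ℂ) :=
    ⟨fun x => (f (AddCircle.toCircle x : ℂ) : ℂ), by
      have := AddCircle.continuous_toCircle (T := (1 : ℝ))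
      fun_prop⟩
  have hg : g ∈ closure (Submodule.span ℂ (Set.range (fourier (T := (1 : ℝ)))) : Set _) := by
    have := span_fourier_closure_eq_top (T := (1 : ℝ))
    rw [← Submodule.topologicalClosure_coe, this]
    trivial
  obtain ⟨p, hp, hpg⟩ := Metric.mem_closure_iff.1 hg ε hε
  -- Taking real parts is not `ℂ`-linear, so the induction carries an arbitrary factor `c`.
  have key : ∀ p ∈ Submodule.span ℂ (Set.range (fourier (T := (1 : ℝ)))), ∀ c : ℂ,
      ∃ F : ℂ → ℂ, Differentiable ℂ F ∧
        ∀ x : AddCircle (1 : ℝ), (c * p x).re = (F (AddCircle.toCircle x : ℂ)).re := by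
    intro p hp
    induction hp using Submodule.span_induction with
    | mem p hp =>
      obtain ⟨k, rfl⟩ := hp
      intro c
      obtain ⟨m, rfl | rfl⟩ := k.eq_nat_or_neg
      · refine ⟨fun z => c * z ^ m, by fun_prop, fun x => ?_⟩
        rw [fourier_apply, AddCircle.toCircle_zsmul]
        simp
      · refine ⟨fun z => (starRingEnd ℂ) c * z ^ m, by fun_prop, fun x => ?_⟩
        rw [fourier_apply, AddCircle.toCircle_zsmul, ← Complex.conj_re]
        simp [← Circle.coe_inv_eq_conj]
    | zero => exact fun c => ⟨0, by fun_prop, fun x => by simp⟩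
    | add p q _ _ hp hq =>
      intro c
      obtain ⟨F, hF, hFp⟩ := hp c
      obtain ⟨G, hG, hGq⟩ := hq c
      refine ⟨F + G, hF.add hG, fun x => ?_⟩
      simp only [ContinuousMap.add_apply, mul_add, Complex.add_re, Pi.add_apply, hFp x, hGq x]
    | smul a p _ hp =>
      intro c
      obtain ⟨F, hF, hFp⟩ := hp (c * a)
      exact ⟨F, hF, fun x => by rw [← hFp x]; simp [mul_assoc]⟩
  obtain ⟨F, hF, hFp⟩ := key p hp 1
  refine ⟨F, hF, fun t ht => ?_⟩
  obtain ⟨x, hx⟩ := (AddCircle.homeomorphCircle (T := (1 : ℝ)) one_ne_zero).surjective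
    ⟨t, by simpa [Submonoid.unitSphere] using ht⟩
  have hxt : (AddCircle.toCircle x : ℂ) = t := by
    rw [← AddCircle.homeomorphCircle_apply one_ne_zero, hx]
  have h1 : dist (g x) (p x) ≤ ε := (ContinuousMap.dist_apply_le_dist x).trans hpg.le
  have h2 := hFp x
  rw [one_mul, hxt] at h2
  rw [← h2]
  have h3 : g x = (f t : ℂ) := by simp [g, hxt]
  rw [h3, dist_eq_norm] at h1
  refine le_trans ?_ h1
  simpa using Complex.abs_re_le_norm ((f t : ℂ) - p x)

/-! ### Minimum principle -/

section MinimumPrinciple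

variable {V : Type*} [NormedAddCommGroup V] [InnerProductSpace ℂ V]

theorem circleAverage_norm_sq (a b : V) :
    Real.circleAverage (fun t : ℂ => ‖a + t • b‖ ^ 2) 0 1 = ‖a‖ ^ 2 + ‖b‖ ^ 2 := by
  have h : Set.EqOn (fun t : ℂ => ‖a + t • b‖ ^ 2)
      (fun t : ℂ => (((‖a‖ ^ 2 + ‖b‖ ^ 2 : ℝ) : ℂ) + 2 * (t * inner ℂ a b)).re)
      (Metric.sphere 0 |1|) := by
    intro t ht
    have ht' : ‖t‖ = 1 := by simpa using ht
    have := norm_add_sq (𝕜 := ℂ) a (t • b)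
    rw [inner_smul_right, norm_smul, ht', one_mul] at this
    simp only [this, Complex.add_re, Complex.ofReal_re, Complex.mul_re (2 : ℂ), Complex.re_ofNat,
      Complex.im_ofNat, RCLike.re_to_complex]
    ring
  rw [Real.circleAverage_congr_sphere h, circleAverage_re (by fun_prop), zero_mul, mul_zero, add_zero, Complex.ofReal_re]

/-- Minimum principle: a lower semicontinuous function that dominates a function `q` with the mean
value property at the points of `B`, and satisfies a super-mean value inequality over some circle
at the points of `C \ B`, dominates `q` on the compact set `C`. -/
theorem ofReal_le_of_supermean {C B : Set V} (hC : IsCompact C) {s : V → ENNReal}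
    (hs : LowerSemicontinuousOn s C) {q : V → ℝ} (hq : Continuous q)
    (hmean : ∀ a b, Real.circleAverage (fun t : ℂ => q (a + t • b)) 0 1 = q a)
    (hB : ∀ z ∈ C ∩ B, ENNReal.ofReal (q z) ≤ s z)
    (hloc : ∀ a ∈ C \ B, ∃ b : V, b ≠ 0 ∧ (∀ t : ℂ, ‖t‖ = 1 → a + t • b ∈ C) ∧
      discMean s a b ≤ s a) :
    ∀ z ∈ C, ENNReal.ofReal (q z) ≤ s z := by
  obtain ⟨R, hR⟩ : ∃ R, ∀ z ∈ C, ‖z‖ ^ 2 ≤ R := by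
    obtain ⟨R, hR⟩ := hC.bddAbove_image (f := fun z => ‖z‖ ^ 2) (by fun_prop)
    exact ⟨R, fun z hz => hR ⟨z, hz, rfl⟩⟩
  -- The perturbation `ε * ‖z‖ ^ 2` has circle means exceeding its central value by `ε * ‖b‖ ^ 2`,
  -- so a finite minimum of `s - r` can only lie on `B`. The shift by `M` keeps everything
  -- nonnegative.
  have main : ∀ ε : ℝ, 0 < ε → ∀ z ∈ C, ENNReal.ofReal (q z) ≤ s z + ENNReal.ofReal (ε * R) := by
    intro ε hε z hz
    set r : V → ℝ := fun z => q z + ε * ‖z‖ ^ 2 with hr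
    have hrc : Continuous r := by fun_prop
    obtain ⟨M, hM⟩ : ∃ M, ∀ z ∈ C, r z < M := by
      obtain ⟨M, hM⟩ := hC.bddAbove_image hrc.continuousOn
      exact ⟨M + 1, fun z hz => (hM ⟨z, hz, rfl⟩).trans_lt (lt_add_one M)⟩
    have hψ : LowerSemicontinuousOn (fun z => s z + ENNReal.ofReal (M - r z)) C :=
      hs.add (ENNReal.continuous_ofReal.comp (by fun_prop)).continuousOn.lowerSemicontinuousOn
    obtain ⟨a, ha, hmin⟩ := hψ.exists_isMinOn ⟨z, hz⟩ hC
    have hmin : ∀ y ∈ C, s a + ENNReal.ofReal (M - r a) ≤ s y + ENNReal.ofReal (M - r y) := hmin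
    by_cases hsa : s a = ⊤
    · have := hmin z hz
      rw [hsa, top_add, top_le_iff, ENNReal.add_eq_top] at this
      rw [this.resolve_right ENNReal.ofReal_ne_top, top_add]
      exact le_top
    by_cases haB : a ∈ B
    · have h1 := hB a ⟨ha, haB⟩
      have h2 : ENNReal.ofReal (M - ε * R) ≤ s z + ENNReal.ofReal (M - r z) := by
        calc ENNReal.ofReal (M - ε * R) ≤ ENNReal.ofReal (q a + (M - r a)) := by
              apply ENNReal.ofReal_le_ofReal
              have := mul_le_mul_of_nonneg_left (hR a ha) hε.le
              simp only [hr]; linarith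
          _ ≤ ENNReal.ofReal (q a) + ENNReal.ofReal (M - r a) := ENNReal.ofReal_add_le
          _ ≤ s a + ENNReal.ofReal (M - r a) := by gcongr
          _ ≤ _ := hmin z hz
      have hMr : 0 ≤ M - r z := by linarith [hM z hz]
      by_cases hsz : s z = ⊤
      · simp [hsz]
      lift s z to NNReal using hsz with x
      have hR0 : 0 ≤ R := (sq_nonneg _).trans (hR z hz)
      rw [← ENNReal.ofReal_coe_nnreal, ← ENNReal.ofReal_add x.coe_nonneg hMr,
        ENNReal.ofReal_le_ofReal_iff (by have := x.2; linarith)] at h2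
      rw [← ENNReal.ofReal_coe_nnreal, ← ENNReal.ofReal_add x.coe_nonneg (by positivity)]
      apply ENNReal.ofReal_le_ofReal
      have : 0 ≤ ε * ‖z‖ ^ 2 := by positivity
      simp only [hr] at h2
      linarith
    -- At a minimum off `B`, the circle mean is at least the central value, yet at most that value
    -- minus `ε * ‖b‖ ^ 2`.
    · exfalso
      obtain ⟨b, hb, hbC, hav⟩ := hloc a ⟨ha, haB⟩
      have hint : ∀ f : ℂ → ℝ, Continuous f → CircleIntegrable f 0 1 :=
        fun f hf => hf.continuousOn.circleIntegrable'
      have hav' : Real.circleAverage (fun t : ℂ => M - r (a + t • b)) 0 1 =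
          M - (r a + ε * ‖b‖ ^ 2) := by
        rw [Real.circleAverage_fun_sub (hint _ (by fun_prop)) (hint _ (by fun_prop)),
          Real.circleAverage_const]
        simp only [hr]
        rw [Real.circleAverage_fun_add (hint _ (by fun_prop)) (hint _ (by fun_prop)), hmean]
        have := Real.circleAverage_fun_smul (a := ε) (f := fun t : ℂ => ‖a + t • b‖ ^ 2)
          (c := 0) (R := 1)
        simp only [smul_eq_mul] at this
        rw [this, circleAverage_norm_sq]
        ring
      have hcirc := discMean_ofReal (s := fun z => ENNReal.ofReal (M - r z)) (a := a) (b := b)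
        (F := fun t => M - r (a + t • b)) (by fun_prop)
        (fun t ht => sub_nonneg.2 (hM _ (hbC t ht)).le) (fun _ _ => rfl)
      rw [hav'] at hcirc
      have h1 : s a + ENNReal.ofReal (M - r a) ≤
          s a + ENNReal.ofReal (M - (r a + ε * ‖b‖ ^ 2)) := by
        calc s a + ENNReal.ofReal (M - r a)
            = discMean (fun _ : V => s a + ENNReal.ofReal (M - r a)) a b :=
              (discMean_const _ _ _).symm
          _ ≤ discMean (fun y => s y + ENNReal.ofReal (M - r y)) a b :=
              discMean_mono fun t ht => hmin _ (hbC t ht)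
          _ = discMean s a b + discMean (fun y => ENNReal.ofReal (M - r y)) a b :=
              lintegral_add_right _
                (ENNReal.continuous_ofReal.comp (by fun_prop : Continuous fun θ : ℝ =>
                  M - r (a + Complex.exp (θ * Complex.I) • b))).measurable
          _ ≤ _ := by rw [hcirc]; gcongr
      rw [ENNReal.add_le_add_iff_left hsa, ENNReal.ofReal_le_ofReal_iff'] at h1
      have hb2 : 0 < ε * ‖b‖ ^ 2 := by positivity
      rcases h1 with h1 | h1
      · linarith
      · linarith [hM a ha]
  intro z hz
  refine ENNReal.le_of_forall_pos_le_add fun δ hδ _ => ?_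
  have hR0 : 0 ≤ R := (sq_nonneg _).trans (hR z hz)
  refine (main (δ / (R + 1)) (by positivity) z hz).trans ?_
  gcongr
  rw [ENNReal.ofReal_le_iff_le_toReal ENNReal.coe_ne_top, ENNReal.coe_toReal, div_mul_eq_mul_div,
    div_le_iff₀ (by positivity)]
  have : (0 : ℝ) ≤ δ := δ.2
  nlinarith

end MinimumPrinciple

/-! ### Locality of the super-mean value property, and gluing -/

/-- One circle per interior point suffices. On the unit circle `s` is an increasing limit of
continuous `T k`, each within `ε / 2` of some `Re F`. The minimum principle gives `Re F 0 - ε / 2 ≤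
s 0`, while the mean of `T k` is at most `Re F 0 + ε / 2`. -/
theorem discMean_unitDisc_le {s : ℂ → ENNReal}
    (hs : LowerSemicontinuousOn s (Metric.closedBall 0 1))
    (hloc : ∀ a ∈ Metric.ball (0 : ℂ) 1, ∃ b : ℂ, b ≠ 0 ∧
      (∀ t : ℂ, ‖t‖ = 1 → a + t • b ∈ Metric.closedBall (0 : ℂ) 1) ∧ discMean s a b ≤ s a) :
    discMean s 0 1 ≤ s 0 := by
  obtain ⟨T, hTc, hTm, hTt, hTs⟩ := exists_monotone_continuous_iSup_eq
    (hs.mono (Metric.sphere_subset_closedBall (x := (0 : ℂ)) (ε := 1)))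
  have hsup : discMean s 0 1 = ⨆ k, discMean (T k) 0 1 := by
    unfold discMean
    rw [← lintegral_iSup (f := fun k (θ : ℝ) => T k (0 + Complex.exp (θ * Complex.I) • 1))
      (fun k => ((hTc k).comp (by fun_prop : Continuous fun θ : ℝ =>
        (0 : ℂ) + Complex.exp (θ * Complex.I) • (1 : ℂ))).measurable)
      (fun k l hkl θ => hTm hkl _)]
    refine lintegral_congr fun θ => (hTs _ ?_).symm
    simp
  rw [hsup]
  refine iSup_le fun k => ENNReal.le_of_forall_pos_le_add fun ε hε _ => ?_
  have hf : Continuous fun z => (T k z).toReal :=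
    ENNReal.continuousOn_toReal.comp_continuous (hTc k) (hTt k)
  have hε2 : (0 : ℝ) < ε / 2 := by positivity
  obtain ⟨F, hF, hFT⟩ := exists_differentiable_re_approx hf hε2
  have hFc := hF.continuous
  have hmin := ofReal_le_of_supermean (C := Metric.closedBall (0 : ℂ) 1) (B := Metric.sphere 0 1)
    (isCompact_closedBall _ _) hs (q := fun z => (F z - (ε / 2 : ℝ)).re) (by fun_prop)
    (fun a b => by
      rw [circleAverage_re (f := fun t => F (a + t • b) - (ε / 2 : ℝ)) (by fun_prop)]
      simp)
    (fun z hz => by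
      have hz1 : z ∈ Metric.sphere (0 : ℂ) 1 := hz.2
      have h1 := abs_le.1 (hFT z (by simpa using hz1))
      rw [← hTs z hz1]
      refine le_trans ?_ (le_iSup _ k)
      rw [← ENNReal.ofReal_toReal (hTt k z)]
      apply ENNReal.ofReal_le_ofReal
      rw [Complex.sub_re, Complex.ofReal_re]
      linarith [h1.1])
    (fun a ha => hloc a (by
      have h1 := ha.1
      have h2 := ha.2
      simp only [Metric.mem_closedBall, Metric.mem_sphere, Metric.mem_ball] at *
      exact lt_of_le_of_ne h1 h2)) 0 (by simp)
  have hmean : discMean (T k) 0 1 = ENNReal.ofReal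
      (Real.circleAverage (fun z => (T k z).toReal) 0 1) :=
    discMean_ofReal hf (fun _ _ => ENNReal.toReal_nonneg)
      (fun c _ => by simp [ENNReal.ofReal_toReal (hTt k c)])
  have hle : Real.circleAverage (fun z => (T k z).toReal) 0 1 ≤ (F 0 - (ε / 2 : ℝ)).re + ε := by
    have h1 : Real.circleAverage (fun z => (T k z).toReal) 0 1 ≤
        Real.circleAverage (fun z => (F z + (ε / 2 : ℝ)).re) 0 1 := by
      refine Real.circleAverage_mono hf.continuousOn.circleIntegrable'
        (Continuous.continuousOn (by fun_prop)).circleIntegrable' fun z hz => ?_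
      have := abs_le.1 (hFT z (by simpa using hz))
      rw [Complex.add_re, Complex.ofReal_re]
      linarith [this.2]
    rw [circleAverage_re (by fun_prop)] at h1
    simp only [Complex.add_re, Complex.sub_re, Complex.ofReal_re] at h1 ⊢
    linarith
  rw [hmean]
  calc _ ≤ ENNReal.ofReal ((F 0 - (ε / 2 : ℝ)).re + ε) := ENNReal.ofReal_le_ofReal hle
    _ ≤ ENNReal.ofReal (F 0 - (ε / 2 : ℝ)).re + ENNReal.ofReal ε := ENNReal.ofReal_add_le
    _ ≤ _ := by rw [ENNReal.ofReal_coe_nnreal]; gcongr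

section Glue

variable {V : Type*} [NormedAddCommGroup V] [NormedSpace ℂ V]

/-- The super-mean value property is local. -/
theorem IsDiscSuperharmonic.of_local {Ω : Set V} {s : V → ENNReal}
    (hs : LowerSemicontinuousOn s Ω)
    (hloc : ∀ a ∈ Ω, ∃ ρ > 0, ∀ b : V, ‖b‖ < ρ → discMean s a b ≤ s a) :
    IsDiscSuperharmonic Ω s where
  lsc := hs
  supermean a _ b hd := by
    have key := discMean_unitDisc_le (s := fun t : ℂ => s (a + t • b))
      (hs.comp (g := fun t : ℂ => a + t • b) (by fun_prop) fun t ht => hd t (by simpa using ht)) ?_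
    · simpa [discMean] using key
    intro t ht
    have ht' : ‖t‖ < 1 := by simpa using ht
    obtain ⟨ρ, hρ, hmean⟩ := hloc (a + t • b) (hd t ht'.le)
    have hbpos : 0 < ‖b‖ + 1 := by positivity
    -- The first bound keeps the circle in the unit disc, the second makes `‖r • b‖ < ρ`; the `+ 1`
    -- covers `b = 0`.
    set r : ℝ := min (1 - ‖t‖) (ρ / (‖b‖ + 1)) with hr
    have hr0 : 0 < r := lt_min (by linarith) (by positivity)
    refine ⟨r, by exact_mod_cast hr0.ne', fun c hc => ?_, ?_⟩
    · have h1 : ‖t + c • (r : ℂ)‖ ≤ ‖t‖ + r := by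
        refine (norm_add_le _ _).trans ?_
        rw [norm_smul, hc, one_mul, Complex.norm_real, Real.norm_of_nonneg hr0.le]
      have h2 : r ≤ 1 - ‖t‖ := min_le_left _ _
      simp only [Metric.mem_closedBall, dist_zero_right]
      linarith
    · have h1 : ‖(r : ℂ) • b‖ < ρ := by
        rw [norm_smul, Complex.norm_real, Real.norm_of_nonneg hr0.le]
        calc r * ‖b‖ < r * (‖b‖ + 1) := by nlinarith
          _ ≤ ρ / (‖b‖ + 1) * (‖b‖ + 1) := by
              gcongr
              exact min_le_right _ _
          _ = ρ := by field_simp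
      refine le_trans (le_of_eq ?_) (hmean _ h1)
      unfold discMean
      refine lintegral_congr fun θ => ?_
      simp only [smul_eq_mul, add_smul, smul_smul, add_assoc]

omit [NormedSpace ℂ V] in
-- Compactness of the ball of translations makes the lower bound uniform in `τ`.
theorem lowerSemicontinuousAt_iInf_translate [ProperSpace V] {Ω : Set V} (hΩ : IsOpen Ω)
    {s : V → ENNReal} (hs : LowerSemicontinuousOn s Ω) {a : V} {δ : ℝ}
    (ha : Metric.closedBall a δ ⊆ Ω) :
    LowerSemicontinuousAt (fun z => ⨅ τ ∈ Metric.closedBall (0 : V) δ, s (z + τ)) a := by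
  intro y hy
  obtain ⟨y', hyy', hy'⟩ := exists_between hy
  have h : ∀ᶠ z in 𝓝 a, ∀ τ ∈ Metric.closedBall (0 : V) δ, y' < s (z + τ) := by
    refine (isCompact_closedBall (0 : V) δ).eventually_forall_of_forall_eventually fun τ hτ => ?_
    have hmem : a + τ ∈ Ω := ha (by simpa using hτ)
    have h1 : ∀ᶠ z in 𝓝 (a + τ), y' < s z := by
      have := hs (a + τ) hmem y' (hy'.trans_le (iInf₂_le τ hτ))
      rwa [hΩ.nhdsWithin_eq hmem] at this
    have h2 : Tendsto (fun z : V × V => z.1 + z.2) (𝓝 (a, τ)) (𝓝 (a + τ)) :=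
      continuous_add.tendsto (a, τ)
    exact h2.eventually h1
  filter_upwards [h] with z hz
  exact hyy'.trans_le (le_iInf₂ fun τ hτ => (hz τ hτ).le)

/-- The minimum of a superharmonic function `P` with the infimum of the translates of another one
that dominates `P` near the boundary. -/
theorem IsDiscSuperharmonic.min_iInf_translate [ProperSpace V] {Ω : Set V} (hΩ : IsOpen Ω)
    {P s : V → ENNReal} (hP : IsDiscSuperharmonic Ω P) (hs : IsDiscSuperharmonic Ω s) {δ : ℝ}
    (hδ : 0 < δ)
    (hnear : ∀ z ∈ Ω, (∃ x ∈ frontier Ω, dist z x < 2 * δ) →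
      ∀ τ ∈ Metric.closedBall (0 : V) δ, P z ≤ s (z + τ)) :
    IsDiscSuperharmonic Ω fun z => min (P z) (⨅ τ ∈ Metric.closedBall (0 : V) δ, s (z + τ)) := by
  have heq : ∀ z ∈ Ω, (∃ x ∈ frontier Ω, dist z x < 2 * δ) →
      min (P z) (⨅ τ ∈ Metric.closedBall (0 : V) δ, s (z + τ)) = P z := fun z hz hx =>
    min_eq_left (le_iInf₂ (hnear z hz hx))
  -- A connected ball centred in `Ω` and missing the frontier stays in `Ω`. Radius `2 * δ`
  -- accommodates a translation by `δ` followed by a disc of radius below `δ`.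
  have hball : ∀ a ∈ Ω, (¬ ∃ x ∈ frontier Ω, dist a x < 2 * δ) → Metric.ball a (2 * δ) ⊆ Ω := by
    intro a ha hx
    have : NormedSpace ℝ V := NormedSpace.restrictScalars ℝ ℂ V
    refine (convex_ball a (2 * δ)).isPreconnected.subset_left_of_subset_union hΩ
      isClosed_closure.isOpen_compl
      (Set.disjoint_compl_right_iff_subset.2 subset_closure) (fun y hy => ?_)
      ⟨a, Metric.mem_ball_self (by positivity), ha⟩
    by_contra hyu
    rw [Set.mem_union, not_or, Set.mem_compl_iff, not_not] at hyu
    refine hx ⟨y, ⟨hyu.2, ?_⟩, by rwa [dist_comm]⟩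
    rw [hΩ.interior_eq]
    exact hyu.1
  refine IsDiscSuperharmonic.of_local ?_ ?_
  · intro a ha
    by_cases hx : ∃ x ∈ frontier Ω, dist a x < 2 * δ
    · obtain ⟨x, hxf, hxd⟩ := hx
      have hev : ∀ᶠ z in 𝓝[Ω] a, P z =
          min (P z) (⨅ τ ∈ Metric.closedBall (0 : V) δ, s (z + τ)) := by
        filter_upwards [self_mem_nhdsWithin, mem_nhdsWithin_of_mem_nhds
          ((isOpen_lt (continuous_id.dist continuous_const) continuous_const).mem_nhds hxd)]
          with z hz hzd
        exact (heq z hz ⟨x, hxf, hzd⟩).symm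
      intro y hy
      filter_upwards [hev, hP.lsc a ha y (by simpa only [heq a ha ⟨x, hxf, hxd⟩] using hy)] with z h1 h2
      rwa [← h1]
    · refine LowerSemicontinuousWithinAt.inf (hP.lsc a ha) ?_
      refine (lowerSemicontinuousAt_iInf_translate hΩ hs.lsc ?_).lowerSemicontinuousWithinAt Ω
      exact (Metric.closedBall_subset_ball (by linarith)).trans (hball a ha hx)
  · intro a ha
    by_cases hx : ∃ x ∈ frontier Ω, dist a x < 2 * δ
    -- At `a` the minimum equals `P a`, and it is at most `P` everywhere, so the inequality for `P`
    -- suffices.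
    · obtain ⟨ρ, hρ, hρΩ⟩ := Metric.isOpen_iff.1 hΩ a ha
      refine ⟨ρ, hρ, fun b hb => ?_⟩
      rw [heq a ha hx]
      refine (discMean_mono fun c _ => min_le_left _ _).trans (hP.supermean a ha b fun t ht => ?_)
      refine hρΩ ?_
      rw [Metric.mem_ball, dist_eq_norm, add_sub_cancel_left, norm_smul]
      nlinarith [norm_nonneg b]
    · have hsub := hball a ha hx
      refine ⟨δ, hδ, fun b hb => ?_⟩
      have hmem : ∀ τ ∈ Metric.closedBall (0 : V) δ, ∀ t : ℂ, ‖t‖ ≤ 1 → (a + τ) + t • b ∈ Ω := by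
        intro τ hτ t ht
        refine hsub ?_
        have h1 : ‖τ‖ ≤ δ := by simpa using hτ
        rw [Metric.mem_ball, dist_eq_norm, add_assoc, add_sub_cancel_left]
        refine (norm_add_le _ _).trans_lt ?_
        rw [norm_smul]
        nlinarith [norm_nonneg b]
      refine le_min ?_ (le_iInf₂ fun τ hτ => ?_)
      · refine (discMean_mono fun c _ => min_le_left _ _).trans (hP.supermean a ha b fun t ht => ?_)
        simpa using hmem 0 (by simpa using hδ.le) t ht
      · calc _ ≤ discMean (fun z => s (z + τ)) a b :=
              discMean_mono fun c _ => (min_le_right _ _).trans (iInf₂_le τ hτ)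
          _ = discMean s (a + τ) b := by
              unfold discMean
              refine lintegral_congr fun θ => ?_
              rw [add_right_comm]
          _ ≤ _ := hs.supermean _ (by simpa using hmem τ hτ 0 (by simp)) b (hmem τ hτ)

end Glue

variable {Ω : Set (Cn n)}

theorem toENNReal_coe_sub_coe (c x : ℝ) :
    ((c : EReal) - (x : EReal)).toENNReal = ENNReal.ofReal (c - x) := by
  rw [← EReal.coe_sub, EReal.toENNReal_of_ne_top (EReal.coe_ne_top _), EReal.toReal_coe]

/-! ### Maximum principle and barriers -/

/-- Maximum principle for plurisubharmonic functions that are continuous up to the boundary. -/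
theorem IsPSH.nonpos_of_frontier [Nontrivial (Cn n)] (hΩ : IsOpen Ω)
    (hb : Bornology.IsBounded Ω) {h : Cn n → ℝ} (hc : ContinuousOn h (closure Ω))
    (hh : IsPSH Ω fun z => (h z : EReal)) (hf : ∀ ζ ∈ frontier Ω, h ζ ≤ 0) :
    ∀ z ∈ Ω, h z ≤ 0 := by
  have hcomp : IsCompact (closure Ω) := hb.isCompact_closure
  obtain ⟨c, hc0, hcz⟩ : ∃ c : ℝ, 0 ≤ c ∧ ∀ z ∈ closure Ω, h z ≤ c := by
    obtain ⟨c, hc⟩ := hcomp.bddAbove_image hc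
    exact ⟨max c 0, le_max_right _ _, fun z hz => (hc ⟨z, hz, rfl⟩).trans (le_max_left _ _)⟩
  have hs := hh.isDiscSuperharmonic hc0
    (fun z hz => EReal.coe_le_coe_iff.2 (hcz z (subset_closure hz)))
  simp only [toENNReal_coe_sub_coe] at hs
  -- The minimum principle for `c - h`, compared with the constant `c`.
  have key := ofReal_le_of_supermean (B := frontier Ω) hcomp
    (s := fun z => ENNReal.ofReal (c - h z)) (q := fun _ => c)
    (ENNReal.continuous_ofReal.comp_continuousOn
      (continuousOn_const.sub hc)).lowerSemicontinuousOn continuous_const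
    (fun a b => Real.circleAverage_const _ _ _)
    (fun z hz => ENNReal.ofReal_le_ofReal (by linarith [hf z hz.2])) ?_
  · intro z hz
    have := key z (subset_closure hz)
    rw [ENNReal.ofReal_le_ofReal_iff (sub_nonneg.2 (hcz z (subset_closure hz)))] at this
    linarith
  rintro a ⟨ha, haf⟩
  have haΩ : a ∈ Ω := by
    by_contra hna
    exact haf ⟨ha, by rwa [hΩ.interior_eq]⟩
  obtain ⟨ρ, hρ, hρΩ⟩ := Metric.isOpen_iff.1 hΩ a haΩ
  obtain ⟨v, hv⟩ := exists_ne (0 : Cn n)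
  have hv' : 0 < ‖v‖ := norm_pos_iff.2 hv
  have hbn : ‖((ρ / 2 / ‖v‖ : ℝ) : ℂ) • v‖ = ρ / 2 := by
    rw [norm_smul, Complex.norm_real, Real.norm_of_nonneg (by positivity)]
    field_simp
  have hd : ∀ t : ℂ, ‖t‖ ≤ 1 → a + t • (((ρ / 2 / ‖v‖ : ℝ) : ℂ) • v) ∈ Ω := by
    intro t ht
    refine hρΩ ?_
    rw [Metric.mem_ball, dist_eq_norm, add_sub_cancel_left, norm_smul, hbn]
    nlinarith
  refine ⟨((ρ / 2 / ‖v‖ : ℝ) : ℂ) • v, ?_, fun t ht => subset_closure (hd t ht.le),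
    hs.supermean a haΩ _ hd⟩
  rw [← norm_pos_iff, hbn]
  positivity

/-- Supplies the nonzero disc directions that the maximum principle needs. -/
theorem nontrivial_of_frontier_nonempty {X : Type*} [TopologicalSpace X] {S : Set X}
    (h : (frontier S).Nonempty) : Nontrivial X := by
  by_contra hX
  rw [not_nontrivial_iff_subsingleton] at hX
  rcases S.eq_empty_or_nonempty with rfl | hS
  · simp at h
  · rw [Subsingleton.eq_univ_of_nonempty hS] at h
    simp at h

/-- On a B-regular domain, continuous superharmonic barriers with prescribed boundary values. -/
theorem IsBRegular.exists_barrier (hΩ : IsBRegular Ω) {K O : Set (Cn n)} (hK : IsCompact K)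
    (hO : IsOpen O) (hKO : K ⊆ O) (hKf : K ⊆ frontier Ω) :
    ∃ p : Cn n → ℝ, ContinuousOn p (closure Ω) ∧
      IsDiscSuperharmonic Ω (fun z => ENNReal.ofReal (p z)) ∧ (∀ ζ ∈ K, p ζ = 2) ∧
      (∀ ζ ∈ frontier Ω, ζ ∉ O → p ζ = 0) ∧ ∀ ζ ∈ frontier Ω, p ζ ≤ 2 := by
  rcases (frontier Ω).eq_empty_or_nonempty with hf | hf
  · rw [hf] at hKf ⊢
    refine ⟨fun _ => 0, continuousOn_const, IsDiscSuperharmonic.const _,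
      fun ζ hζ => (hKf hζ).elim, by simp, by simp⟩
  have := nontrivial_of_frontier_nonempty hf
  obtain ⟨f, hf0, hf1, hf01⟩ := exists_continuous_zero_one_of_isClosed hO.isClosed_compl
    hK.isClosed (Set.disjoint_compl_left_iff_subset.2 hKO)
  -- The barrier is `-h`, where `h` extends `-2` times a Urysohn function; `h ≤ 0` by the maximum
  -- principle. The value `2` leaves room for `p > 1` near `K`.
  obtain ⟨h, hc, hpsh, hval⟩ := hΩ.extend
    ⟨fun ζ => -2 * f ζ, by have := f.continuous; fun_prop⟩
  have hval' : ∀ ζ ∈ frontier Ω, h ζ = -2 * f ζ := fun ζ hζ => hval ⟨ζ, hζ⟩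
  have hle := hpsh.nonpos_of_frontier hΩ.isOpen hΩ.isBounded hc
    (fun ζ hζ => by linarith [hval' ζ hζ, (hf01 ζ).1])
  have hs := hpsh.isDiscSuperharmonic le_rfl (fun z hz => EReal.coe_le_coe_iff.2 (hle z hz))
  simp only [toENNReal_coe_sub_coe, zero_sub] at hs
  refine ⟨fun z => -h z, hc.neg, hs, fun ζ hζ => ?_, fun ζ hζ hζO => ?_, fun ζ hζ => ?_⟩
  · have : f ζ = 1 := hf1 hζ
    simp only [hval' ζ (hKf hζ), this]; norm_num
  · have : f ζ = 0 := hf0 hζO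
    simp only [hval' ζ hζ, this]; norm_num
  · linarith [hval' ζ hζ, (hf01 ζ).2]

/-! ### Separation of the singular set from points off the hull -/

/-- If `s ≥ 2` near the compact set `K ⊆ ∂Ω`, then there is a superharmonic function that is at
least `1` near `K`, and at most `s w + ε` in a whole neighbourhood of the point `w ∈ Ω`. -/
theorem IsBRegular.exists_locally_bounded (hΩ : IsBRegular Ω) {K : Set (Cn n)} (hK : IsCompact K)
    (hKf : K ⊆ frontier Ω) {s : Cn n → ENNReal} (hs : IsDiscSuperharmonic Ω s)
    (hs2 : ∀ ζ ∈ K, ∀ᶠ z in 𝓝[Ω] ζ, 2 ≤ s z) {w : Cn n} (hw : w ∈ Ω) {ε : ℝ} (hε : 0 < ε) :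
    ∃ t : Cn n → ENNReal, IsDiscSuperharmonic Ω t ∧ (∀ ζ ∈ K, ∀ᶠ z in 𝓝[Ω] ζ, 1 ≤ t z) ∧
      ∀ᶠ z in 𝓝[Ω] w, t z ≤ s w + ENNReal.ofReal ε := by
  classical
  have hO : ∃ O : Set (Cn n), IsOpen O ∧ K ⊆ O ∧ ∀ z ∈ O ∩ Ω, 2 ≤ s z := by
    have h1 : ∀ ζ ∈ K, ∃ U : Set (Cn n), IsOpen U ∧ ζ ∈ U ∧ U ∩ Ω ⊆ {z | 2 ≤ s z} := fun ζ hζ =>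
      mem_nhdsWithin.1 (hs2 ζ hζ)
    choose! U hUo hUm hUs using h1
    refine ⟨⋃ ζ ∈ K, U ζ, isOpen_biUnion hUo, fun ζ hζ => Set.mem_biUnion hζ (hUm ζ hζ), ?_⟩
    rintro z ⟨hz, hzΩ⟩
    obtain ⟨ζ, hζ, hzU⟩ := Set.mem_iUnion₂.1 hz
    exact hUs ζ hζ ⟨hzU, hzΩ⟩
  obtain ⟨O, hOo, hKO, hOs⟩ := hO
  obtain ⟨p, hpc, hp, hpK, hpO, hp2⟩ := hΩ.exists_barrier hK hOo hKO hKf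
  -- The value `⊤` off `Ω` makes translates that leave `Ω` irrelevant; `ε` absorbs the oscillation
  -- of `p` near the boundary.
  set σ : Cn n → ENNReal := fun z => if z ∈ Ω then s z + ENNReal.ofReal ε else ⊤ with hσ
  have hσΩ : ∀ z ∈ Ω, σ z = s z + ENNReal.ofReal ε := fun z hz => if_pos hz
  have hσs : IsDiscSuperharmonic Ω σ := by
    have h1 := hs.add (IsDiscSuperharmonic.const (ENNReal.ofReal ε))
    refine ⟨fun a ha y hy => ?_, fun a ha b hd => ?_⟩
    · filter_upwards [self_mem_nhdsWithin, h1.lsc a ha y (by simpa only [hσΩ a ha] using hy)]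
        with z hz h2
      simpa only [hσΩ z hz] using h2
    · rw [hσΩ a ha, discMean_congr (t := fun z => s z + ENNReal.ofReal ε)
        fun c hc => hσΩ _ (hd c hc.le)]
      exact h1.supermean a ha b hd
  -- Near `ζ ∈ O` one has `p ζ ≤ 2 ≤ s`; off `O`, `p ζ = 0`. The points `z` and `z'` are
  -- independent, as translation requires.
  have hclose : ∀ ζ ∈ frontier Ω, ∃ r > 0, ∀ z ∈ Metric.ball ζ r ∩ Ω, ∀ z' ∈ Metric.ball ζ r,
      ENNReal.ofReal (p z) ≤ σ z' := by
    intro ζ hζ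
    have hpζ : ∀ᶠ z in 𝓝[Ω] ζ, p z < p ζ + ε :=
      ((hpc ζ (frontier_subset_closure hζ)).mono_left (nhdsWithin_mono ζ subset_closure)).eventually
        (gt_mem_nhds (by linarith))
    have hsζ : ∀ᶠ z in 𝓝[Ω] ζ, ENNReal.ofReal (p ζ) ≤ s z := by
      by_cases hζO : ζ ∈ O
      · filter_upwards [self_mem_nhdsWithin, mem_nhdsWithin_of_mem_nhds (hOo.mem_nhds hζO)]
          with z hz hzO
        refine le_trans ?_ (hOs z ⟨hzO, hz⟩)
        simpa using ENNReal.ofReal_le_ofReal (hp2 ζ hζ)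
      · rw [hpO ζ hζ hζO]
        simp
    obtain ⟨r, hr, hrs⟩ := Metric.mem_nhdsWithin_iff.1 (hpζ.and hsζ)
    refine ⟨r, hr, fun z hz z' hz' => ?_⟩
    by_cases hz'Ω : z' ∈ Ω
    · rw [hσΩ z' hz'Ω]
      calc ENNReal.ofReal (p z) ≤ ENNReal.ofReal (p ζ + ε) :=
            ENNReal.ofReal_le_ofReal (hrs hz).1.le
        _ ≤ ENNReal.ofReal (p ζ) + ENNReal.ofReal ε := ENNReal.ofReal_add_le
        _ ≤ _ := by
          gcongr
          exact (hrs ⟨hz', hz'Ω⟩).2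
    · simp [hσ, hz'Ω]
  choose! r hr hrs using hclose
  have hfc : IsCompact (frontier Ω) :=
    hΩ.isBounded.isCompact_closure.of_isClosed_subset isClosed_frontier frontier_subset_closure
  obtain ⟨δ, hδ, hδr⟩ := lebesgue_number_lemma_of_metric hfc
    (c := fun ζ : frontier Ω => Metric.ball (ζ : Cn n) (r ζ)) (fun _ => Metric.isOpen_ball)
    (fun ζ hζ => Set.mem_iUnion.2 ⟨⟨ζ, hζ⟩, Metric.mem_ball_self (hr ζ hζ)⟩)
  -- With `δ` a Lebesgue number, `z` and `z + τ` lie within `3 * δ / 4` of the boundary point `x`.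
  have hδ4 : 0 < δ / 4 := by positivity
  have hnear : ∀ z ∈ Ω, (∃ x ∈ frontier Ω, dist z x < 2 * (δ / 4)) →
      ∀ τ ∈ Metric.closedBall (0 : Cn n) (δ / 4), ENNReal.ofReal (p z) ≤ σ (z + τ) := by
    rintro z hz ⟨x, hx, hzx⟩ τ hτ
    obtain ⟨ζ, hζ⟩ := hδr x hx
    refine hrs ζ ζ.2 z ⟨hζ ?_, hz⟩ (z + τ) (hζ ?_)
    · rw [Metric.mem_ball]; linarith
    · have h1 : dist (z + τ) z ≤ δ / 4 := by simpa [dist_eq_norm] using hτ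
      have := dist_triangle (z + τ) z x
      rw [Metric.mem_ball]; linarith
  refine ⟨_, hp.min_iInf_translate hΩ.isOpen hσs hδ4 hnear, fun ζ hζ => ?_, ?_⟩
  · have hζf := hKf hζ
    have h1 : ∀ᶠ z in 𝓝[Ω] ζ, 1 < p z :=
      ((hpc ζ (frontier_subset_closure hζf)).mono_left
        (nhdsWithin_mono ζ subset_closure)).eventually (lt_mem_nhds (by rw [hpK ζ hζ]; norm_num))
    filter_upwards [self_mem_nhdsWithin, h1,
      mem_nhdsWithin_of_mem_nhds (Metric.ball_mem_nhds ζ (by positivity : 0 < 2 * (δ / 4)))]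
      with z hz hpz hzζ
    rw [min_eq_left (le_iInf₂ (hnear z hz ⟨ζ, hζf, hzζ⟩))]
    simpa using ENNReal.ofReal_le_ofReal hpz.le
  · filter_upwards [mem_nhdsWithin_of_mem_nhds (Metric.ball_mem_nhds w hδ4)] with z hz
    -- The translation by `w - z` carries `z` to `w`, so only the value `s w` matters.
    refine (min_le_right _ _).trans ((iInf₂_le (w - z) ?_).trans ?_)
    · rw [mem_closedBall_zero_iff, ← dist_eq_norm, dist_comm]
      exact (Metric.mem_ball.1 hz).le
    · rw [add_sub_cancel, hσΩ w hw]

/-- Separation of a point outside the hull from a compact subset of the singular set. -/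
theorem IsBRegular.exists_separating (hΩ : IsBRegular Ω) {E K : Set (Cn n)} (hK : IsCompact K)
    (hKf : K ⊆ frontier Ω) (hKE : K ⊆ E) {w : Cn n} (hw : w ∈ closure Ω)
    (hwE : w ∉ bPluripolarHull Ω E) {η : ℝ} (hη : 0 < η) :
    ∃ t : Cn n → ENNReal, IsDiscSuperharmonic Ω t ∧ (∀ ζ ∈ K, ∀ᶠ z in 𝓝[Ω] ζ, 1 ≤ t z) ∧
      ∀ᶠ z in 𝓝[Ω] w, t z ≤ ENNReal.ofReal η := by
  obtain ⟨u, ⟨hu, hu0, huE⟩, huw⟩ : ∃ u ∈ singularFamily Ω E, upperReg Ω u w ≠ ⊥ := by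
    by_contra! hcon
    exact hwE ⟨hw, hcon⟩
  by_cases hwΩ : w ∈ Ω
  · have huw' : u w ≠ ⊥ := by
      intro hb
      refine huw (le_bot_iff.1 ?_)
      rw [← hb]
      exact upperSemicontinuousWithinAt_iff_limsup_le.1 (hu.usc w hwΩ)
    have hs := hu.isDiscSuperharmonic le_rfl (fun z hz => (hu0 z hz).le)
    obtain ⟨x, hx⟩ : ∃ x : NNReal, (((0 : ℝ) : EReal) - u w).toENNReal = x := by
      refine ⟨_, (ENNReal.coe_toNNReal ?_).symm⟩
      simpa using huw'
    -- With `x = -u w`, scaling by `c` uses half of `η`; the translation argument uses the other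
    -- half.
    set c : ℝ := η / 2 / (x + 1) with hc
    have hc0 : 0 < c := by positivity
    have hcx : c * x ≤ η / 2 := by
      rw [hc, div_mul_eq_mul_div, div_le_iff₀ (by positivity)]
      nlinarith [x.2]
    have hs2 : ∀ ζ ∈ K, ∀ᶠ z in 𝓝[Ω] ζ,
        2 ≤ ENNReal.ofReal c * (((0 : ℝ) : EReal) - u z).toENNReal := by
      intro ζ hζ
      have h1 : upperReg Ω u ζ < ((-(2 / c) : ℝ) : EReal) := by
        rw [huE ζ (hKE hζ)]
        exact EReal.bot_lt_coe _
      filter_upwards [eventually_lt_of_limsup_lt h1] with z hz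
      have h2 : ENNReal.ofReal (2 / c) ≤ (((0 : ℝ) : EReal) - u z).toENNReal := by
        have := EReal.toENNReal_le_toENNReal (EReal.sub_le_sub (le_refl ((0 : ℝ) : EReal)) hz.le)
        rwa [toENNReal_coe_sub_coe, zero_sub, neg_neg] at this
      calc (2 : ENNReal) = ENNReal.ofReal c * ENNReal.ofReal (2 / c) := by
            rw [← ENNReal.ofReal_mul hc0.le, mul_div_cancel₀ _ hc0.ne']
            simp
        _ ≤ _ := by gcongr
    obtain ⟨t, ht, htK, htw⟩ := hΩ.exists_locally_bounded hK hKf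
      (hs.const_mul (c := ENNReal.ofReal c) ENNReal.ofReal_ne_top) hs2 hwΩ (half_pos hη)
    refine ⟨t, ht, htK, htw.mono fun z hz => hz.trans ?_⟩
    rw [hx, ← ENNReal.ofReal_coe_nnreal, ← ENNReal.ofReal_mul hc0.le,
      ← ENNReal.ofReal_add (by positivity) (by positivity)]
    apply ENNReal.ofReal_le_ofReal
    linarith
  -- At a boundary point, `w ∉ K` suffices: a barrier vanishing at `w` separates.
  · have hwf : w ∈ frontier Ω := ⟨hw, by rwa [hΩ.isOpen.interior_eq]⟩
    have hwK : w ∉ K := fun h => huw (huE w (hKE h))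
    obtain ⟨p, hpc, hp, hpK, hpO, -⟩ := hΩ.exists_barrier hK (O := {w}ᶜ) isOpen_compl_singleton
      (fun ζ hζ h => hwK (h ▸ hζ)) hKf
    have hp0 : p w = 0 := hpO w hwf (by simp)
    have hlim : ∀ ζ ∈ frontier Ω, Tendsto p (𝓝[Ω] ζ) (𝓝 (p ζ)) := fun ζ hζ =>
      (hpc ζ (frontier_subset_closure hζ)).mono_left (nhdsWithin_mono ζ subset_closure)
    refine ⟨_, hp, fun ζ hζ => ?_, ?_⟩
    · filter_upwards [(hlim ζ (hKf hζ)).eventually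
        (lt_mem_nhds (show 1 < p ζ by rw [hpK ζ hζ]; norm_num))] with z hz
      simpa using ENNReal.ofReal_le_ofReal hz.le
    · filter_upwards [(hlim w hwf).eventually (gt_mem_nhds (show p w < η by rwa [hp0]))] with z hz
      exact ENNReal.ofReal_le_ofReal hz.le

/-- Uniform version of the separation, over a compact set that misses the hull. -/
theorem IsBRegular.exists_separating_of_isCompact (hΩ : IsBRegular Ω) {E K U : Set (Cn n)}
    (hK : IsCompact K) (hKf : K ⊆ frontier Ω) (hKE : K ⊆ E) (hU : IsCompact U)
    (hUΩ : U ⊆ closure Ω) (hUE : Disjoint U (bPluripolarHull Ω E)) {η : ℝ} (hη : 0 < η) :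
    ∃ t : Cn n → ENNReal, IsDiscSuperharmonic Ω t ∧ (∀ ζ ∈ K, ∀ᶠ z in 𝓝[Ω] ζ, 1 ≤ t z) ∧
      ∀ z ∈ U ∩ Ω, t z ≤ ENNReal.ofReal η := by
  refine hU.induction_on (p := fun S => ∃ t : Cn n → ENNReal, IsDiscSuperharmonic Ω t ∧
    (∀ ζ ∈ K, ∀ᶠ z in 𝓝[Ω] ζ, 1 ≤ t z) ∧ ∀ z ∈ S ∩ Ω, t z ≤ ENNReal.ofReal η) ?_ ?_ ?_ ?_
  · exact ⟨_, IsDiscSuperharmonic.const 1, by simp, by simp⟩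
  · rintro S T hST ⟨t, h1, h2, h3⟩
    exact ⟨t, h1, h2, fun z hz => h3 z ⟨hST hz.1, hz.2⟩⟩
  · rintro S T ⟨t, h1, h2, h3⟩ ⟨t', h1', h2', h3'⟩
    refine ⟨_, h1.inf h1', fun ζ hζ => ?_, ?_⟩
    · filter_upwards [h2 ζ hζ, h2' ζ hζ] with z hz hz' using le_min hz hz'
    · rintro z ⟨hz | hz, hzΩ⟩
      · exact (min_le_left _ _).trans (h3 z ⟨hz, hzΩ⟩)
      · exact (min_le_right _ _).trans (h3' z ⟨hz, hzΩ⟩)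
  · intro w hw
    obtain ⟨t, h1, h2, h3⟩ := hΩ.exists_separating hK hKf hKE (hUΩ hw)
      (Set.disjoint_left.1 hUE hw) hη
    refine ⟨{z | z ∈ Ω → t z ≤ ENNReal.ofReal η},
      mem_nhdsWithin_of_mem_nhds (eventually_nhdsWithin_iff.1 h3), t, h1, h2, fun z hz => hz.1 hz.2⟩

/-! ### The two inclusions -/

/-- The set of points at which an extended real function is discontinuous or infinite is a
countable union of compact sets. -/
theorem exists_isCompact_iUnion_eq_singularSet (hb : Bornology.IsBounded Ω)
    (φ : frontier Ω → EReal) :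
    ∃ K : ℕ → Set (Cn n), (∀ i, IsCompact (K i)) ∧ singularSet φ = ⋃ i, K i := by
  have : CompactSpace (frontier Ω) := isCompact_iff_compactSpace.1
    (hb.isCompact_closure.of_isClosed_subset isClosed_frontier frontier_subset_closure)
  have hG : IsGδ {ζ : frontier Ω | ¬ (¬ ContinuousAt φ ζ ∨ φ ζ = ⊤ ∨ φ ζ = ⊥)} := by
    -- At a continuity point, finiteness of `φ` persists nearby, so the finite continuity points
    -- form the Gδ set of continuity points cut by an open set.
    have heq : {ζ : frontier Ω | ¬ (¬ ContinuousAt φ ζ ∨ φ ζ = ⊤ ∨ φ ζ = ⊥)} =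
        {ζ | ContinuousAt φ ζ} ∩ interior (φ ⁻¹' {x | x ≠ ⊤ ∧ x ≠ ⊥}) := by
      ext ζ
      rw [Set.mem_inter_iff, Set.mem_ofPred_eq, Set.mem_ofPred_eq, not_or, not_or, not_not]
      refine ⟨fun h => ⟨h.1, ?_⟩, fun h => ⟨h.1, interior_subset (s := φ ⁻¹' _) h.2⟩⟩
      rw [mem_interior_iff_mem_nhds]
      refine h.1.preimage_mem_nhds (IsOpen.mem_nhds ?_ h.2)
      exact isOpen_ne.inter isOpen_ne
    rw [heq]
    exact (IsGδ.setOfPred_continuousAt φ).inter isOpen_interior.isGδ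
  obtain ⟨f, hfo, hf⟩ := isGδ_iff_eq_iInter_nat.1 hG
  refine ⟨fun i => Subtype.val '' (f i)ᶜ, fun i =>
    ((hfo i).isClosed_compl.isCompact).image continuous_subtype_val, ?_⟩
  rw [← Set.image_iUnion, ← Set.compl_iInter, ← hf, singularSet]
  congr 1
  ext ζ
  simp only [Set.mem_compl_iff, Set.mem_ofPred_eq, not_not]

theorem closure_bPluripolarHull_subset_propagatingSet (E : Set (Cn n)) :
    closure (bPluripolarHull Ω E) ⊆ propagatingSet Ω E := by
  intro z hz
  refine ⟨closure_minimal (fun y hy => hy.1) isClosed_closure hz, fun u hu => ?_⟩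
  by_contra hne
  obtain ⟨c, hc, hcu⟩ := exists_between (bot_lt_iff_ne_bot.2 hne)
  obtain ⟨O, hO, hzO, hOu⟩ := mem_nhdsWithin.1 (eventually_lt_of_lt_liminf hcu)
  obtain ⟨y, hyO, hy⟩ := mem_closure_iff.1 hz O hO hzO
  have : (𝓝[Ω] y).NeBot := mem_closure_iff_nhdsWithin_neBot.1 hy.1
  have h1 : c ≤ lowerReg Ω u y := by
    refine le_liminf_of_le (by isBoundedDefault) ?_
    filter_upwards [self_mem_nhdsWithin, mem_nhdsWithin_of_mem_nhds (hO.mem_nhds hyO)]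
      with x hx hxO using (hOu ⟨hxO, hx⟩ : c < u x).le
  have h2 : lowerReg Ω u y ≤ upperReg Ω u y := liminf_le_limsup
  rw [hy.2 u hu, le_bot_iff] at h2
  rw [h2] at h1
  exact absurd hc (not_lt.2 h1)

/-- Outside the closure of the hull of a countable union of compact sets there is no propagation
of singularities. -/
theorem IsBRegular.propagatingSet_subset_closure (hΩ : IsBRegular Ω) {E : Set (Cn n)}
    (hEf : E ⊆ frontier Ω) {K : ℕ → Set (Cn n)} (hK : ∀ i, IsCompact (K i))
    (hE : E = ⋃ i, K i) : propagatingSet Ω E ⊆ closure (bPluripolarHull Ω E) := by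
  rintro z₀ ⟨hz₀, hprop⟩
  by_contra hz
  obtain ⟨ρ, hρ, hρE⟩ := Metric.nhds_basis_closedBall.mem_iff.1
    (isClosed_closure.isOpen_compl.mem_nhds hz)
  have hU : IsCompact (Metric.closedBall z₀ ρ ∩ closure Ω) :=
    (isCompact_closedBall z₀ ρ).inter_right isClosed_closure
  have hUE : Disjoint (Metric.closedBall z₀ ρ ∩ closure Ω) (bPluripolarHull Ω E) :=
    Set.disjoint_left.2 fun x hx hxE => hρE hx.1 (subset_closure hxE)
  have hKE : ∀ j, Set.accumulate K j ⊆ E := fun j => by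
    rw [hE]
    exact Set.accumulate_subset_iUnion j
  obtain ⟨η, hη0, hη⟩ := ENNReal.exists_pos_sum_of_countable one_ne_zero ℕ
  -- The accumulated compacts increase, so each point of `E` lies in all but finitely many of them,
  -- and infinitely many `t j` are at least `1` near it.
  choose t ht htK htU using fun j => hΩ.exists_separating_of_isCompact
    (isCompact_accumulate hK j) ((hKE j).trans hEf) (hKE j) hU Set.inter_subset_right hUE
    (NNReal.coe_pos.2 (hη0 j))
  -- The summand `1` makes the negated sum strictly negative.
  have hs := (IsDiscSuperharmonic.const (Ω := Ω) (1 : ENNReal)).add (IsDiscSuperharmonic.tsum ht)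
  have hsU : ∀ z ∈ Metric.closedBall z₀ ρ ∩ Ω, 1 + ∑' j, t j z ≤ 2 := by
    rintro z ⟨hz, hzΩ⟩
    have h1 : ∑' j, t j z ≤ ∑' j, (η j : ENNReal) := ENNReal.tsum_le_tsum fun j => by
      simpa using htU j z ⟨⟨hz, subset_closure hzΩ⟩, hzΩ⟩
    calc 1 + ∑' j, t j z ≤ 1 + 1 := by gcongr; exact h1.trans hη.le
      _ = 2 := one_add_one_eq_two
  have hfin : ∃ z ∈ Ω, 1 + ∑' j, t j z ≠ ⊤ := by
    obtain ⟨z, hz, hzΩ⟩ := mem_closure_iff_nhds.1 hz₀ _ (Metric.closedBall_mem_nhds z₀ hρ)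
    exact ⟨z, hzΩ, ne_top_of_le_ne_top (by simp) (hsU z ⟨hz, hzΩ⟩)⟩
  have hpsh := hs.isPSH_neg (fun z _ => by positivity) hfin
  have hlow := hprop _ ⟨hpsh, fun z hz => ?_, fun ζ hζ => ?_⟩
  · have h2 : (-2 : EReal) ≤ lowerReg Ω (fun z => -((1 + ∑' j, t j z : ENNReal) : EReal)) z₀ := by
      refine le_liminf_of_le (by isBoundedDefault) ?_
      filter_upwards [self_mem_nhdsWithin,
        mem_nhdsWithin_of_mem_nhds (Metric.closedBall_mem_nhds z₀ hρ)] with z hzΩ hz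
      rw [EReal.neg_le_neg_iff]
      exact EReal.coe_ennreal_le_coe_ennreal_iff.2 (hsU z ⟨hz, hzΩ⟩)
    rw [hlow, le_bot_iff] at h2
    exact absurd h2 (by decide)
  · rw [EReal.neg_lt_comm, neg_zero]
    exact_mod_cast (by positivity : (0 : ENNReal) < 1 + ∑' j, t j z)
  · obtain ⟨i, hi⟩ := Set.mem_iUnion.1 (hE ▸ hζ)
    rw [EReal.eq_bot_iff_forall_lt]
    intro y
    obtain ⟨N, hN⟩ := exists_nat_gt (-y)
    -- Only `N` terms are used, so their neighbourhoods of `ζ` intersect in a neighbourhood.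
    have hev : ∀ᶠ z in 𝓝[Ω] ζ, ∀ j ∈ Finset.Ico i (i + N), 1 ≤ t j z := by
      rw [eventually_all_finset]
      intro j hj
      exact htK j ζ (Set.mem_accumulate.2 ⟨i, (Finset.mem_Ico.1 hj).1, hi⟩)
    refine lt_of_le_of_lt (b := ((-(N : ℝ) : ℝ) : EReal)) ?_ (EReal.coe_lt_coe_iff.2 (by linarith))
    refine limsup_le_of_le (by isBoundedDefault) ?_
    filter_upwards [hev] with z hz
    have h1 : (N : ENNReal) ≤ 1 + ∑' j, t j z := by
      calc (N : ENNReal) = ∑ j ∈ Finset.Ico i (i + N), 1 := by simp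
        _ ≤ ∑ j ∈ Finset.Ico i (i + N), t j z := Finset.sum_le_sum hz
        _ ≤ ∑' j, t j z := ENNReal.sum_le_tsum _
        _ ≤ _ := le_add_self
    have h2 : ((N : ENNReal) : EReal) ≤ ((1 + ∑' j, t j z : ENNReal) : EReal) :=
      EReal.coe_ennreal_le_coe_ennreal_iff.2 h1
    rw [EReal.coe_neg, EReal.neg_le_neg_iff]
    refine le_trans (le_of_eq ?_) h2
    norm_cast

end Pluripotential

end

theorem proposition4p2 (n : ℕ) (Ω : Set (Pluripotential.Cn n))
    (hΩ : Pluripotential.IsBRegular Ω) (φ : frontier Ω → EReal)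
    (hφ : Pluripotential.IsBPluripolar Ω (Pluripotential.singularSet φ)) :
    Pluripotential.propagatingSet Ω (Pluripotential.singularSet φ) =
      closure (Pluripotential.bPluripolarHull Ω (Pluripotential.singularSet φ)) := by
  obtain ⟨K, hK, hE⟩ :=
    Pluripotential.exists_isCompact_iUnion_eq_singularSet hΩ.isBounded φ
  exact (hΩ.propagatingSet_subset_closure hφ.1 hK hE).antisymm
    (Pluripotential.closure_bPluripolarHull_subset_propagatingSet _)
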